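/- Let $m\ge 2$, let $\mathcal T$ be the $m$-adic rooted tree, whose vertices are the finite words in the alphabet $X=\{1,\dots,m\}$ (a word is joined by an edge to each of its extensions by one letter), and let $\mathrm{Aut}\,\mathcal T$ be its group of graph automorphisms. Let $\sigma=(1\,2\,\cdots\,m)\in\mathrm{Sym}(m)$, and let $a,b\in\mathrm{Aut}\,\mathcal T$ be the automorphisms fixing the empty word and defined recursively by $a=(1,\dots,1,a)\sigma$ and $b=(1,\dots,1,b^{-1})\sigma$. That is, for every word $w$, both $a$ and $b$ send $xw$ to $\sigma(x)w$ if $x\in X\setminus\{m\}$, while $a$ sends $mw$ to $1\,a(w)$ and $b$ sends $mw$ to $1\,b^{-1}(w)$. Let $H=\langle a,b\rangle$ be the generalized Brunner-Sidki-Vieira group and $H'=[H,H]$ its commutator subgroup. For $G\le\mathrm{Aut}\,\mathcal T$ and $n\ge 0$ let $\mathrm{St}_G(n)$ be the subgroup of elements of $G$ fixing every word of length $n$, and for $n\ge 1$ put $$s_n(G)=m\log_m|\mathrm{St}_G(n-1):\mathrm{St}_G(n)|-\log_m|\mathrm{St}_G(n):\mathrm{St}_G(n+1)|.$$ Let $e_n=n-2\lfloor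 n/2\rfloor$, and let $\tau=0$ if $m$ is odd and $\tau=1$ if $m$ is even. Then for every $m\ge 2$ and every $n\ge 1$, $$s_n(H')=(m-1)\big((2e_n-1)\,\tau\log_m 2-e_n\big).$$ -/

import Mathlib

namespace BSV

/-- The `m`-adic tree: vertices are the finite words in the letters `Fin m`, and two words are joined
by an edge when one of them is obtained from the other by appending one letter on the right. -/
def adicTree (m : ℕ) : SimpleGraph (List (Fin m)) where
  Adj u v := (∃ x, u = v ++ [x]) ∨ (∃ x, v = u ++ [x])
  symm := ⟨fun _ _ h => h.symm⟩
  loopless := ⟨by rintro u (⟨x, h⟩ | ⟨x, h⟩) <;> simpa using congrArg List.length h⟩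

/-- `Aut T`: the group of graph automorphisms of the `m`-adic tree. Products are compositions,
`(g * h) v = g (h v)`; the opposite convention has the same subgroups, the same commutator
subgroups and the same indices. -/
abbrev TreeAut (m : ℕ) := adicTree m ≃g adicTree m

/-- The `n`th level stabilizer `St(n)`: the automorphisms that fix every word of length `n`. -/
def levelStab (m n : ℕ) : Subgroup (TreeAut m) where
  carrier := {g | ∀ v : List (Fin m), v.length = n → g v = v}
  one_mem' := fun _ _ => rfl
  mul_mem' := fun {g h} hg hh v hv => by
    change g (h v) = v
    rw [hh v hv, hg v hv]
  inv_mem' := fun {g} hg v hv => by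
    change g.symm v = v
    conv_lhs => rw [← hg v hv]
    exact g.symm_apply_apply v

/-- `St_G(n) = St(n) ∩ G`. -/
def stab {m : ℕ} (G : Subgroup (TreeAut m)) (n : ℕ) : Subgroup (TreeAut m) :=
  levelStab m n ⊓ G

/-- The sequence `s_n = m log_m |St_G(n-1) : St_G(n)| - log_m |St_G(n) : St_G(n+1)|`, for `n ≥ 1`.
For subgroups `B ≤ A`, the index `|A : B|` is `B.relIndex A`. -/
noncomputable def sSeq {m : ℕ} (G : Subgroup (TreeAut m)) (n : ℕ) : ℝ :=
  m * Real.logb m ((stab G n).relIndex (stab G (n - 1)))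
    - Real.logb m ((stab G (n + 1)).relIndex (stab G n))

/-- Adding (`true`) or subtracting (`false`) one on words, by means of the cycle
`finRotate m : x ↦ x + 1` on the first letter. When there is a carry or a borrow, the remaining
word is treated in the same way, in the direction `c d` if the current direction is `d`. -/
def stepFun (m : ℕ) (c : Bool → Bool) : Bool → List (Fin m) → List (Fin m)
  | _, [] => []
  | true, x :: w => finRotate m x :: (if (x : ℕ) + 1 = m then stepFun m c (c true) w else w)
  | false, x :: w => (finRotate m).symm x ::
      (if ((finRotate m).symm x : ℕ) + 1 = m then stepFun m c (c false) w else w)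

theorem stepFun_not (m : ℕ) (c : Bool → Bool) (hc : ∀ d, c (!d) = !(c d)) (d : Bool)
    (w : List (Fin m)) : stepFun m c (!d) (stepFun m c d w) = w := by
  induction w generalizing d with
  | nil => cases d <;> rfl
  | cons x w ih =>
    cases d
    · have h := hc false
      simp only [Bool.not_false] at h
      simp only [stepFun, Bool.not_false, Equiv.apply_symm_apply]
      split_ifs with h1
      · rw [h, ih]
      · rfl
    · have h := hc true
      simp only [Bool.not_true] at h
      simp only [stepFun, Bool.not_true, Equiv.symm_apply_apply]
      split_ifs with h1
      · rw [h, ih]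
      · rfl

theorem stepFun_append (m : ℕ) (c : Bool → Bool) (d : Bool) (w : List (Fin m)) (x : Fin m) :
    ∃ y, stepFun m c d (w ++ [x]) = stepFun m c d w ++ [y] := by
  induction w generalizing d with
  | nil => cases d <;> simp [stepFun]
  | cons z w ih =>
    cases d
    · simp only [stepFun, List.cons_append]
      split_ifs with h
      · obtain ⟨y, hy⟩ := ih (c false)
        exact ⟨y, by rw [hy]⟩
      · exact ⟨x, rfl⟩
    · simp only [stepFun, List.cons_append]
      split_ifs with h
      · obtain ⟨y, hy⟩ := ih (c true)
        exact ⟨y, by rw [hy]⟩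
      · exact ⟨x, rfl⟩

theorem stepFun_adj (m : ℕ) (c : Bool → Bool) (d : Bool) (u v : List (Fin m))
    (h : (adicTree m).Adj u v) : (adicTree m).Adj (stepFun m c d u) (stepFun m c d v) := by
  rcases h with ⟨x, rfl⟩ | ⟨x, rfl⟩
  · exact Or.inl (stepFun_append m c d v x)
  · exact Or.inr (stepFun_append m c d u x)

/-- The tree automorphism `stepFun m c true`, with inverse `stepFun m c false`. -/
def stepAut (m : ℕ) (c : Bool → Bool) (hc : ∀ d, c (!d) = !(c d)) : TreeAut m where
  toFun := stepFun m c true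
  invFun := stepFun m c false
  left_inv := stepFun_not m c hc true
  right_inv := stepFun_not m c hc false
  map_rel_iff' := by
    intro u v
    refine ⟨fun h => ?_, stepFun_adj m c true u v⟩
    have h2 := stepFun_adj m c false _ _ h
    have e1 : stepFun m c false (stepFun m c true u) = u := stepFun_not m c hc true u
    have e2 : stepFun m c false (stepFun m c true v) = v := stepFun_not m c hc true v
    change (adicTree m).Adj (stepFun m c false (stepFun m c true u))
      (stepFun m c false (stepFun m c true v)) at h2
    rwa [e1, e2] at h2

/-- The generator `a`, with `ψ(a) = (1, …, 1, a)σ`; see `a_nil` and `a_cons`. -/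
def a (m : ℕ) : TreeAut m := stepAut m id (fun _ => rfl)

/-- The generator `b`, with `ψ(b) = (1, …, 1, b⁻¹)σ`; see `b_nil` and `b_cons`. -/
def b (m : ℕ) : TreeAut m := stepAut m not (fun _ => rfl)

theorem a_nil (m : ℕ) : a m [] = [] := rfl

theorem b_nil (m : ℕ) : b m [] = [] := rfl

/-- `a` acts on first letters as the cycle `σ`; its section at the last letter is `a`, and its
sections at the other letters are trivial. -/
theorem a_cons (m : ℕ) (x : Fin m) (w : List (Fin m)) :
    a m (x :: w) = finRotate m x :: (if (x : ℕ) + 1 = m then a m w else w) := rfl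

/-- `b` acts on first letters as the cycle `σ`; its section at the last letter is `b⁻¹`, and its
sections at the other letters are trivial. -/
theorem b_cons (m : ℕ) (x : Fin m) (w : List (Fin m)) :
    b m (x :: w) = finRotate m x :: (if (x : ℕ) + 1 = m then (b m)⁻¹ w else w) := rfl

/-- The generalized Brunner-Sidki-Vieira group `H = ⟨a, b⟩`. -/
def H (m : ℕ) : Subgroup (TreeAut m) := Subgroup.closure {a m, b m}

/-- The commutator subgroup `H' = [H, H]`. -/
def H' (m : ℕ) : Subgroup (TreeAut m) := ⁅H m, H m⁆

theorem stepFun_length (m : ℕ) (c : Bool → Bool) (d : Bool) (w : List (Fin m)) :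
    (stepFun m c d w).length = w.length := by
  induction w generalizing d with
  | nil => cases d <;> rfl
  | cons x w ih => cases d <;> simp only [stepFun, List.length_cons] <;> split_ifs <;> simp [ih]

theorem H_length (m : ℕ) {g : TreeAut m} (hg : g ∈ H m) (v : List (Fin m)) :
    (g v).length = v.length := by
  induction hg using Subgroup.closure_induction generalizing v with
  | mem x hx =>
    rcases hx with rfl | rfl
    · exact stepFun_length m id true v
    · exact stepFun_length m not true v
  | one => rfl
  | mul x y _ _ hx hy => exact (hx (y v)).trans (hy v)
  | inv x _ hx =>
    have h := hx (x.symm v)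
    rw [RelIso.apply_symm_apply] at h
    exact h.symm

/-- All the indices that occur in `sSeq (H' m)` are finite (an infinite index would be `0`). -/
theorem stab_relIndex_ne_zero (m i j : ℕ) :
    (stab (H' m) j).relIndex (stab (H' m) i) ≠ 0 := by
  have hle : H' m ≤ H m := (Subgroup.commutator_le_sup _ _).trans (sup_le le_rfl le_rfl)
  have key : (levelStab m j).relIndex (H m) ≠ 0 := by
    have : Finite {v : List (Fin m) // v.length = j} := List.finite_length_eq _ _
    let φ : H m → ({v : List (Fin m) // v.length = j} → {v : List (Fin m) // v.length = j}) :=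
      fun g v => ⟨(g : TreeAut m) v, by rw [H_length m g.2, v.2]⟩
    have hinj : Function.Injective (fun q : H m ⧸ (levelStab m j).subgroupOf (H m) =>
        φ q.out) := by
      intro p q hpq
      rw [← Quotient.out_eq' p, ← Quotient.out_eq' q]
      refine QuotientGroup.eq.2 ?_
      intro v hv
      have h := congrArg Subtype.val (congrFun hpq ⟨v, hv⟩)
      change (p.out : TreeAut m) v = (q.out : TreeAut m) v at h
      change (p.out : TreeAut m).symm ((q.out : TreeAut m) v) = v
      rw [← h, RelIso.symm_apply_apply]
    have : Finite (H m ⧸ (levelStab m j).subgroupOf (H m)) := Finite.of_injective _ hinj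
    exact Subgroup.index_ne_zero_of_finite
  have h1 : (levelStab m j).relIndex (H' m) ≠ 0 :=
    fun h => key (Subgroup.relIndex_eq_zero_of_le_right hle h)
  have h2 : (stab (H' m) j).relIndex (H' m) ≠ 0 := by
    unfold stab
    rwa [Subgroup.inf_relIndex_right]
  exact fun h => h2 (Subgroup.relIndex_eq_zero_of_le_right inf_le_right h)

/-- `k_n = ⌊n/2⌋` (division in `ℕ` rounds down). -/
def k (n : ℕ) : ℕ := n / 2

/-- `e_n = n - 2 k_n`, the remainder of `n` modulo `2`. -/
def e (n : ℕ) : ℕ := n - 2 * k n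

/-- `τ = 0` if `m` is odd and `τ = 1` if `m` is even. -/
def τ (m : ℕ) : ℕ := if Odd m then 0 else 1

end BSV

namespace BSV

open Subgroup
open scoped commutatorElement

variable {m r : ℕ}

/-! Write C_n = H' St_H(n), and let o_n be the order of ab modulo C_n. An element of H' fixes the
first level, and its tuples of sections are exactly those with i-th entry ≡ (ab)^{l_i} mod H' and ∑
l_i = 0 (`map_branchTuples`). Reducing the entries modulo C_n leaves tuples of powers of ab with
exponent sum zero, of which there are o_n^{m-1}; the tuples with all entries in C_n contribute |H' :
St_{H'}(n)|^m. Hence |H' : St_{H'}(n+1)| = |H' : St_{H'}(n)|^m · o_n^{m-1}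
(`relIndex_levelKer_succ`), and taking logarithms gives s_{n+1}(H') = (m-1)(log_m o_n - log_m
o_{n+1}) (`sSeq_H'_succ`).

It remains to find o_n. If x + y = mk, then modulo H' the element a^x b^y is (a^m)^k (ab⁻¹)^{-y};
its sections are a^k, with an extra factor (ab)^{-y} at one letter. Elements of H' redistribute this
power of ab among the letters, which gives a recursion in n for the lattice of pairs (x, y) with a^x
b^y ∈ C_n (`zpow_mul_zpow_mem_commKer_succ`). At level n+1 the solution is the lattice spanned by
o_{n+1}(1, 1), o_n(1, -1) and (0, m^{n+1}), where o_0 = 1, o_1 = m/2^τ and o_{n+2} = m o_n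
(`isRelation_zero_iff`, `isRelation_succ_iff`, `orderMod_eq`). -/

/-! ### Automorphisms given by tuples of sections -/

theorem adicTree_adj_cons {x y : Fin m} {u v : List (Fin m)} :
    (adicTree m).Adj (x :: u) (y :: v) ↔ x = y ∧ (adicTree m).Adj u v := by
  constructor
  · rintro (⟨z, h⟩ | ⟨z, h⟩) <;> rw [List.cons_append, List.cons.injEq] at h
    · exact ⟨h.1, Or.inl ⟨z, h.2⟩⟩
    · exact ⟨h.1.symm, Or.inr ⟨z, h.2⟩⟩
  · rintro ⟨rfl, ⟨z, h⟩ | ⟨z, h⟩⟩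
    · exact Or.inl ⟨z, by rw [h, List.cons_append]⟩
    · exact Or.inr ⟨z, by rw [h, List.cons_append]⟩

theorem H_apply_nil {g : TreeAut m} (hg : g ∈ H m) : g [] = [] :=
  List.length_eq_zero_iff.1 (H_length m hg [])

/-- The map on words with trivial action on the first letter and with sections `s`. -/
def sectionFun (s : Fin m → H m) : List (Fin m) → List (Fin m)
  | [] => []
  | x :: w => x :: (s x : TreeAut m) w

theorem sectionFun_mul (s t : Fin m → H m) (w : List (Fin m)) :
    sectionFun (s * t) w = sectionFun s (sectionFun t w) := by
  cases w <;> rfl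

theorem sectionFun_one (w : List (Fin m)) : sectionFun (1 : Fin m → H m) w = w := by
  cases w <;> rfl

theorem sectionFun_adj (s : Fin m → H m) {u v : List (Fin m)} (h : (adicTree m).Adj u v) :
    (adicTree m).Adj (sectionFun s u) (sectionFun s v) := by
  have key : ∀ (y : Fin m) (w : List (Fin m)), (adicTree m).Adj [] (y :: w) →
      (adicTree m).Adj (sectionFun s []) (sectionFun s (y :: w)) := by
    rintro y w (⟨z, h⟩ | ⟨z, h⟩)
    · simp at h
    · obtain ⟨rfl, rfl⟩ : y = z ∧ w = [] := by simpa using h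
      exact Or.inr ⟨y, by simp [sectionFun, H_apply_nil (s y).2]⟩
  rcases u with _ | ⟨x, u⟩ <;> rcases v with _ | ⟨y, v⟩
  · exact absurd h ((adicTree m).irrefl)
  · exact key y v h
  · exact (key x u h.symm).symm
  · obtain ⟨rfl, h'⟩ := adicTree_adj_cons.1 h
    exact adicTree_adj_cons.2 ⟨rfl, (s x : TreeAut m).map_rel_iff.2 h'⟩

/-- The inverse of `ψ`: tuples of elements of `H` as automorphisms fixing the first level. -/
def ofSections (m : ℕ) : (Fin m → H m) →* TreeAut m where
  toFun s :=
    { toFun := sectionFun s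
      invFun := sectionFun s⁻¹
      left_inv := fun w => by rw [← sectionFun_mul, inv_mul_cancel, sectionFun_one]
      right_inv := fun w => by rw [← sectionFun_mul, mul_inv_cancel, sectionFun_one]
      map_rel_iff' := by
        intro u v
        refine ⟨fun h => ?_, sectionFun_adj s⟩
        have h2 := sectionFun_adj s⁻¹ h
        simpa only [Equiv.coe_fn_mk, ← sectionFun_mul, inv_mul_cancel, sectionFun_one] using h2 }
  map_one' := RelIso.ext sectionFun_one
  map_mul' s t := RelIso.ext (sectionFun_mul s t)

theorem ofSections_cons (s : Fin m → H m) (x : Fin m) (w : List (Fin m)) :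
    ofSections m s (x :: w) = x :: (s x : TreeAut m) w := rfl

theorem ofSections_nil (s : Fin m → H m) : ofSections m s [] = [] := rfl

theorem ofSections_mem_levelStab {s : Fin m → H m} {n : ℕ} :
    ofSections m s ∈ levelStab m (n + 1) ↔ ∀ x, (s x : TreeAut m) ∈ levelStab m n := by
  constructor
  · intro h x v hv
    have := h (x :: v) (by simp [hv])
    rw [ofSections_cons] at this
    exact (List.cons.inj this).2
  · rintro h (_ | ⟨x, v⟩) hv
    · rfl
    · rw [ofSections_cons, h x v (by simpa using hv)]

/-! ### Generators, sections and conjugation in H -/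

/-- The generator `a` as an element of `H`. -/
def α (m : ℕ) : H m := ⟨a m, subset_closure (Or.inl rfl)⟩

/-- The generator `b` as an element of `H`. -/
def β (m : ℕ) : H m := ⟨b m, subset_closure (Or.inr rfl)⟩

theorem closure_α_β (m : ℕ) : closure {α m, β m} = ⊤ := by
  have h := Subgroup.closure_closure_coe_preimage (k := {a m, b m})
  rw [eq_top_iff]
  refine h.ge.trans ?_
  refine closure_mono ?_
  rintro ⟨x, hx⟩ (h | h)
  · exact Or.inl (Subtype.ext h)
  · exact Or.inr (Subtype.ext h)

/-- Two commuting generators make the quotient by `N` abelian. Containments of H' thus reduce to a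
single commutator. -/
theorem commutator_le_of_commute {G : Type*} [Group G] {x y : G} (hxy : closure {x, y} = ⊤)
    (N : Subgroup G) [N.Normal] (h : ⁅x, y⁆ ∈ N) : commutator G ≤ N := by
  have hc : ∀ g ∈ ({x, y} : Set G), ∀ g' ∈ ({x, y} : Set G),
      (g : G ⧸ N) * (g' : G ⧸ N) = g' * g := by
    have hxy' : (x : G ⧸ N) * y = y * x := by
      rw [← QuotientGroup.mk_mul, ← QuotientGroup.mk_mul, QuotientGroup.eq_iff_div_mem]
      simpa [commutatorElement_def, div_eq_mul_inv, mul_assoc] using h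
    rintro g (rfl | rfl) g' (rfl | rfl)
    · rfl
    · exact hxy'
    · exact hxy'.symm
    · rfl
  have h1 : ∀ g : G, ∀ g' ∈ ({x, y} : Set G), Commute (g : G ⧸ N) (g' : G ⧸ N) := by
    intro g g' hg'
    have hg : g ∈ closure {x, y} := hxy ▸ mem_top g
    induction hg using closure_induction with
    | mem z hz => exact hc z hz g' hg'
    | one => exact Commute.one_left _
    | mul p q _ _ hp hq => exact hp.mul_left hq
    | inv p _ hp => exact hp.inv_left
  have h2 : ∀ g g' : G, Commute (g : G ⧸ N) (g' : G ⧸ N) := by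
    intro g g'
    have hg : g' ∈ closure {x, y} := hxy ▸ mem_top g'
    induction hg using closure_induction with
    | mem z hz => exact h1 g z hz
    | one => exact Commute.one_right _
    | mul p q _ _ hp hq => exact hp.mul_right hq
    | inv p _ hp => exact hp.inv_right
  rw [_root_.commutator_def, commutator_le]
  intro g _ g' _
  rw [← QuotientGroup.eq_one_iff]
  exact commutatorElement_eq_one_iff_mul_comm.2 (h2 g g')

theorem H'_eq_map (m : ℕ) : H' m = (commutator (H m)).map (H m).subtype :=
  (map_subtype_commutator (H m)).symm

/-- Every element of `H` has sections in `H`. -/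
theorem exists_sections {g : TreeAut m} (hg : g ∈ H m) :
    ∃ (π : Equiv.Perm (Fin m)) (s : Fin m → H m), ∀ x w, g (x :: w) = π x :: (s x : TreeAut m) w := by
  induction hg using closure_induction with
  | mem z hz =>
    rcases hz with rfl | rfl
    · refine ⟨finRotate m, fun x => if (x : ℕ) + 1 = m then α m else 1, fun x w => ?_⟩
      rw [a_cons]
      split_ifs with h
      · simp only [if_pos h]; rfl
      · simp only [if_neg h]; rfl
    · refine ⟨finRotate m, fun x => if (x : ℕ) + 1 = m then (β m)⁻¹ else 1, fun x w => ?_⟩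
      rw [b_cons]
      split_ifs with h
      · simp only [if_pos h]; rfl
      · simp only [if_neg h]; rfl
  | one => exact ⟨1, 1, fun _ _ => rfl⟩
  | mul p q _ _ hp hq =>
    obtain ⟨π, s, hs⟩ := hp
    obtain ⟨ρ, t, ht⟩ := hq
    refine ⟨π * ρ, fun x => s (ρ x) * t x, fun x w => ?_⟩
    rw [RelIso.mul_apply, ht, hs]
    rfl
  | inv p _ hp =>
    obtain ⟨π, s, hs⟩ := hp
    refine ⟨π⁻¹, fun x => (s (π⁻¹ x))⁻¹, fun x w => ?_⟩
    refine p.injective ?_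
    rw [hs]
    change p (p.symm _) = _
    simp

theorem conj_ofSections {g : TreeAut m} (hg : g [] = []) {π : Equiv.Perm (Fin m)} {s : Fin m → H m}
    (hs : ∀ x w, g (x :: w) = π x :: (s x : TreeAut m) w) (t : Fin m → H m) :
    g * ofSections m t * g⁻¹ =
      ofSections m (fun x => s (π⁻¹ x) * t (π⁻¹ x) * (s (π⁻¹ x))⁻¹) := by
  rw [mul_inv_eq_iff_eq_mul]
  refine RelIso.ext fun w => ?_
  rcases w with _ | ⟨x, w⟩
  · change g [] = ofSections m _ (g [])
    rw [hg, ofSections_nil]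
  · change g (x :: (t x : TreeAut m) w) = ofSections m _ (g (x :: w))
    rw [hs, hs, ofSections_cons]
    simp

/-! ### The commutator subgroup as a group of tuples -/

/-- The tuples `s` with `s i ≡ (ab) ^ l i` modulo `H'` for some `l` of sum zero. -/
def branchTuples (m : ℕ) : Subgroup (Fin m → H m) where
  carrier := {s | ∃ l : Fin m → ℤ, ∑ i, l i = 0 ∧
    ∀ i, Abelianization.of (s i) = Abelianization.of (α m * β m) ^ l i}
  one_mem' := ⟨0, by simp, fun i => by simp⟩
  mul_mem' := by
    rintro s t ⟨l, hl, hs⟩ ⟨k, hk, ht⟩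
    refine ⟨l + k, by simp [Finset.sum_add_distrib, hl, hk], fun i => ?_⟩
    rw [Pi.mul_apply, _root_.map_mul, hs, ht, Pi.add_apply, zpow_add]
  inv_mem' := by
    rintro s ⟨l, hl, hs⟩
    refine ⟨-l, by simp [hl], fun i => ?_⟩
    rw [Pi.inv_apply, _root_.map_inv, hs, Pi.neg_apply, zpow_neg]

instance : (branchTuples m).Normal where
  conj_mem := by
    rintro s ⟨l, hl, hs⟩ g
    refine ⟨l, hl, fun i => ?_⟩
    rw [← hs, Pi.mul_apply, Pi.mul_apply, Pi.inv_apply, _root_.map_mul, _root_.map_mul,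
      _root_.map_inv, mul_inv_cancel_comm]

/-- Conjugation permutes the coordinates and conjugates each entry; in the abelianization only the
permutation survives, and it preserves the exponent sum. -/
theorem conj_mem_map_branchTuples {g h : TreeAut m} (hg : g ∈ H m)
    (hh : h ∈ (branchTuples m).map (ofSections m)) :
    g * h * g⁻¹ ∈ (branchTuples m).map (ofSections m) := by
  obtain ⟨t, ⟨l, hl, ht⟩, rfl⟩ := hh
  obtain ⟨π, s, hs⟩ := exists_sections hg
  refine ⟨_, ⟨fun x => l (π⁻¹ x), ?_, fun i => ?_⟩, (conj_ofSections (H_apply_nil hg) hs t).symm⟩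
  · rw [← hl]
    exact Equiv.sum_comp π⁻¹ l
  · rw [← ht, _root_.map_mul, _root_.map_mul, _root_.map_inv, mul_inv_cancel_comm]

theorem a_mem_H (m : ℕ) : a m ∈ H m := (α m).2

theorem b_mem_H (m : ℕ) : b m ∈ H m := (β m).2

theorem H'_le_H (m : ℕ) : H' m ≤ H m :=
  (commutator_le_sup _ _).trans (sup_le le_rfl le_rfl)

theorem conj_mem_H' {g h : TreeAut m} (hg : g ∈ H m) (hh : h ∈ H' m) : g * h * g⁻¹ ∈ H' m := by
  have h1 := mul_mem (commutator_mem_commutator hg (H'_le_H m hh)) hh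
  rwa [commutatorElement_def, inv_mul_cancel_right] at h1

theorem a_cons' (x : Fin (r + 1)) (w : List (Fin (r + 1))) : a (r + 1) (x :: w) =
    finRotate _ x :: ((if x = Fin.last r then α (r + 1) else 1 : H (r + 1)) : TreeAut (r + 1)) w := by
  have h : (x : ℕ) + 1 = r + 1 ↔ x = Fin.last r := by simp [Fin.ext_iff]
  rw [a_cons]
  simp only [h]
  split_ifs <;> rfl

theorem conj_a_mulSingle (i : Fin r) (g : H (r + 1)) :
    a (r + 1) * ofSections _ (Pi.mulSingle i.castSucc g) * (a (r + 1))⁻¹ =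
      ofSections _ (Pi.mulSingle i.succ g) := by
  have hi : finRotate (r + 1) i.castSucc = i.succ := by
    ext; simp
  rw [conj_ofSections (a_nil _) a_cons']
  congr 1
  funext x
  obtain ⟨y, rfl⟩ := (finRotate (r + 1)).surjective x
  have hy' : (finRotate (r + 1))⁻¹ (finRotate (r + 1) y) = y := Equiv.symm_apply_apply _ _
  rw [hy']
  by_cases hy : y = i.castSucc
  · subst hy
    simp [hi]
  · have : finRotate (r + 1) y ≠ i.succ := fun h => hy ((finRotate _).injective (h.trans hi.symm))
    simp only [Pi.mulSingle_eq_of_ne hy, Pi.mulSingle_eq_of_ne this, mul_one, mul_inv_cancel]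

theorem mulSingle_mem_of_zero {N : Subgroup (TreeAut (r + 1))}
    (hN : ∀ h ∈ N, a (r + 1) * h * (a (r + 1))⁻¹ ∈ N) {g : H (r + 1)}
    (h0 : ofSections _ (Pi.mulSingle 0 g) ∈ N) (i : Fin (r + 1)) :
    ofSections _ (Pi.mulSingle i g) ∈ N := by
  induction i using Fin.induction with
  | zero => exact h0
  | succ i hi => exact conj_a_mulSingle i g ▸ hN _ hi

/-- The trivial sections cancel; at the last letter, a and b⁻¹ combine to a(b⁻¹)⁻¹ = ab, which lands
at the letter σ(m), here `0`. -/
theorem a_mul_b_inv : a (r + 1) * (b (r + 1))⁻¹ =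
    ofSections _ (Pi.mulSingle 0 (α (r + 1) * β (r + 1))) := by
  rw [mul_inv_eq_iff_eq_mul]
  refine RelIso.ext fun w => ?_
  rcases w with _ | ⟨x, w⟩
  · rfl
  · rw [RelIso.mul_apply, b_cons, a_cons, ofSections_cons]
    congr 1
    by_cases hx : (x : ℕ) + 1 = r + 1
    · obtain rfl : x = Fin.last r := by simpa [Fin.ext_iff] using hx
      rw [finRotate_last, Pi.mulSingle_eq_same, if_pos hx, if_pos hx]
      change a (r + 1) w = a (r + 1) (b (r + 1) ((b (r + 1)).symm w))
      rw [RelIso.apply_symm_apply]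
    · have : finRotate (r + 1) x ≠ 0 := by
        rw [← finRotate_last]
        intro h
        exact hx (by simp [(finRotate _).injective h])
      rw [Pi.mulSingle_eq_of_ne this, if_neg hx, if_neg hx]
      rfl

theorem mulSingle_mem_H (i : Fin (r + 1)) :
    ofSections _ (Pi.mulSingle i (α (r + 1) * β (r + 1))) ∈ H (r + 1) :=
  mulSingle_mem_of_zero (fun _ hh => mul_mem (mul_mem (a_mem_H _) hh) (inv_mem (a_mem_H _)))
    (a_mul_b_inv ▸ mul_mem (a_mem_H _) (inv_mem (b_mem_H _))) i

theorem a_pow_cons (j : ℕ) (x : Fin (r + 1)) (w : List (Fin (r + 1)))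
    (h : (x : ℕ) + j < r + 1) :
    (a (r + 1) ^ j) (x :: w) = ⟨x + j, h⟩ :: w := by
  induction j with
  | zero => rfl
  | succ j ih =>
    rw [pow_succ', RelIso.mul_apply, ih (by omega), a_cons, if_neg (by simp; omega),
      finRotate_of_lt (by omega)]
    rfl

/-- Going once round the cycle, every letter meets exactly one carry. -/
theorem a_pow_card : a (r + 1) ^ (r + 1) = ofSections _ (fun _ => α (r + 1)) := by
  refine RelIso.ext fun w => ?_
  rcases w with _ | ⟨x, w⟩
  · rw [ofSections_nil]
    exact H_apply_nil (pow_mem (a_mem_H _) _)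
  · have hx := x.2
    have h : r + 1 = x + 1 + (r - x) := by omega
    -- The first `r - x` steps reach the last letter, one step carries, and `x` steps return to `x`.
    conv_lhs => rw [show a (r + 1) ^ (r + 1) = a (r + 1) ^ (x : ℕ) * a (r + 1) * a (r + 1) ^ (r - x)
      by rw [← pow_succ, ← pow_add, ← h]]
    rw [RelIso.mul_apply, RelIso.mul_apply, a_pow_cons (r - x) x w (by omega), a_cons,
      if_pos (by simp; omega)]
    have : finRotate (r + 1) ⟨x + (r - x), by omega⟩ = 0 := by
      rw [← finRotate_last]
      congr 1
      ext
      simp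
      omega
    rw [this, a_pow_cons _ _ _ (by simp; omega), ofSections_cons]
    congr 1
    ext
    simp

theorem closure_α_mul (m : ℕ) : closure {α m, α m * β m} = ⊤ := by
  rw [eq_top_iff, ← closure_α_β, closure_le]
  have h1 : α m ∈ closure {α m, α m * β m} := subset_closure (Or.inl rfl)
  have h2 : α m * β m ∈ closure {α m, α m * β m} := subset_closure (Or.inr rfl)
  rintro g (rfl | rfl)
  · exact h1
  · simpa using mul_mem (inv_mem h1) h2

/-- The sections at `0` of elements of H fixing the first level fill H: a^m supplies a, and ab⁻¹
supplies ab. -/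
theorem exists_ofSections_mem_H (g : H (r + 1)) : ∃ s, s 0 = g ∧ ofSections (r + 1) s ∈ H (r + 1) := by
  have h : (⊤ : Subgroup (H (r + 1))) ≤
      ((H (r + 1)).comap (ofSections (r + 1))).map (Pi.evalMonoidHom _ 0) := by
    rw [← closure_α_mul, closure_le]
    rintro g (rfl | rfl)
    · exact ⟨_, show ofSections _ (fun _ => α (r + 1)) ∈ H (r + 1) from
        a_pow_card ▸ pow_mem (a_mem_H _) _, rfl⟩
    · exact ⟨_, mulSingle_mem_H 0, by simp⟩
  obtain ⟨s, hs, hg⟩ := h (mem_top g)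
  exact ⟨s, hg, hs⟩

/-- The elements g with (g, 1, …, 1) ∈ H' form a normal subgroup, by `exists_ofSections_mem_H`. It
contains [a, ab], since [(a, …, a), (ab, 1, …, 1)] = ([a, ab], 1, …, 1). -/
theorem commutator_le_comap_H' : commutator (H (r + 1)) ≤
    (H' (r + 1)).comap ((ofSections (r + 1)).comp (MonoidHom.mulSingle _ 0)) := by
  have hN : ((H' (r + 1)).comap ((ofSections (r + 1)).comp
      (MonoidHom.mulSingle (fun _ => H (r + 1)) 0))).Normal := by
    refine ⟨fun x hx g => ?_⟩
    obtain ⟨s, rfl, hs⟩ := exists_ofSections_mem_H g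
    have := conj_mem_H' hs hx
    rw [MonoidHom.comp_apply, ← _root_.map_inv, ← _root_.map_mul, ← _root_.map_mul] at this
    change ofSections (r + 1) (Pi.mulSingle 0 _) ∈ H' (r + 1)
    convert this using 2
    change _ = s * Pi.mulSingle 0 x * s⁻¹
    funext i
    by_cases hi : i = 0
    · subst hi; simp
    · simp [Pi.mulSingle_eq_of_ne hi]
  refine commutator_le_of_commute (closure_α_mul _) _ ?_
  have h : ⁅a (r + 1) ^ (r + 1), ofSections _ (Pi.mulSingle 0 (α (r + 1) * β (r + 1)))⁆ ∈ H' (r + 1) :=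
    commutator_mem_commutator (pow_mem (a_mem_H _) _) (mulSingle_mem_H 0)
  rw [a_pow_card, ← map_commutatorElement] at h
  change ofSections (r + 1) (Pi.mulSingle 0 _) ∈ H' (r + 1)
  convert h using 2
  funext i
  by_cases hi : i = 0
  · subst hi; simp [commutatorElement_def]
  · simp [commutatorElement_def, Pi.mulSingle_eq_of_ne hi]

theorem ofSections_mem_H'_of_forall_mem {s : Fin (r + 1) → H (r + 1)}
    (hs : ∀ i, s i ∈ commutator (H (r + 1))) : ofSections _ s ∈ H' (r + 1) :=
  pi_mem_of_mulSingle_mem (H := (H' (r + 1)).comap (ofSections (r + 1))) s fun i =>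
    mulSingle_mem_of_zero (fun _ hh => conj_mem_H' (a_mem_H _) hh)
      (commutator_le_comap_H' (hs i)) i

/-- The commutator of a with the tuple carrying ab at `i` is the quotient of neighbouring tuples;
these quotients telescope. -/
theorem mulSingle_div_mem_H' (i : Fin (r + 1)) :
    ofSections _ (Pi.mulSingle i (α (r + 1) * β (r + 1)) /
      Pi.mulSingle 0 (α (r + 1) * β (r + 1))) ∈ H' (r + 1) := by
  induction i using Fin.induction with
  | zero => simp [one_mem]
  | succ i hi =>
    have h := mul_mem (commutator_mem_commutator (a_mem_H (r + 1)) (mulSingle_mem_H i.castSucc)) hi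
    rw [commutatorElement_def, conj_a_mulSingle, ← div_eq_mul_inv, ← _root_.map_div,
      ← _root_.map_mul, div_mul_div_cancel] at h
    exact h

/-- The vectors e_i - e_0 span the integer vectors of sum zero. -/
theorem ofSections_zpow_mem_H' {l : Fin (r + 1) → ℤ} (hl : ∑ i, l i = 0) :
    ofSections _ (fun i => (α (r + 1) * β (r + 1)) ^ l i) ∈ H' (r + 1) := by
  let S : AddSubgroup (Fin (r + 1) → ℤ) :=
    { carrier := {l | ofSections _ (fun i => (α (r + 1) * β (r + 1)) ^ l i) ∈ H' (r + 1)}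
      zero_mem' := by
        have : (fun i => (α (r + 1) * β (r + 1)) ^ (0 : Fin (r + 1) → ℤ) i) = 1 := by
          funext i; simp
        rw [Set.mem_ofPred_eq, this, _root_.map_one]
        exact one_mem _
      add_mem' := by
        intro l k hl hk
        rw [Set.mem_ofPred_eq] at hl hk ⊢
        convert mul_mem hl hk using 1
        rw [← _root_.map_mul]
        congr 1
        funext i
        simp [zpow_add]
      neg_mem' := by
        intro l hl
        rw [Set.mem_ofPred_eq] at hl ⊢
        convert inv_mem hl using 1
        rw [← _root_.map_inv]
        congr 1
        funext i
        simp }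
  have hS : ∀ i, (Pi.single i 1 - Pi.single 0 1 : Fin (r + 1) → ℤ) ∈ S := by
    intro i
    change ofSections _ _ ∈ H' (r + 1)
    convert mulSingle_div_mem_H' i using 2
    funext x
    rw [Pi.div_apply, Pi.sub_apply, zpow_sub, div_eq_mul_inv]
    congr 1
    · by_cases hx : x = i
      · subst hx; simp
      · simp [Pi.single_eq_of_ne hx, Pi.mulSingle_eq_of_ne hx]
    · by_cases hx : x = 0
      · subst hx; simp
      · simp [Pi.single_eq_of_ne hx, Pi.mulSingle_eq_of_ne hx]
  have h : l = ∑ i, l i • (Pi.single i 1 - Pi.single 0 1 : Fin (r + 1) → ℤ) := by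
    simp only [smul_sub, Finset.sum_sub_distrib, ← Finset.sum_smul, hl, zero_smul, sub_zero]
    funext x
    simp [Finset.sum_apply, Pi.single_apply]
  change l ∈ S
  rw [h]
  exact sum_mem fun i _ => zsmul_mem (hS i) _

/-- `H'` is the image of `branchTuples`. -/
theorem map_branchTuples : (branchTuples (r + 1)).map (ofSections (r + 1)) = H' (r + 1) := by
  apply le_antisymm
  · rintro _ ⟨s, ⟨l, hl, hs⟩, rfl⟩
    have h1 : ofSections _ (fun i => s i * ((α (r + 1) * β (r + 1)) ^ l i)⁻¹) ∈ H' (r + 1) := by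
      refine ofSections_mem_H'_of_forall_mem fun i => ?_
      rw [← Abelianization.ker_of, MonoidHom.mem_ker, _root_.map_mul, hs, _root_.map_inv,
        map_zpow, mul_inv_cancel]
    have h2 := mul_mem h1 (ofSections_zpow_mem_H' hl)
    rw [← _root_.map_mul] at h2
    convert h2 using 2
    funext i
    simp
  · rw [H'_eq_map, map_le_iff_le_comap]
    have hN : (((branchTuples (r + 1)).map (ofSections (r + 1))).comap
        (H (r + 1)).subtype).Normal :=
      ⟨fun x hx g => conj_mem_map_branchTuples g.2 hx⟩
    refine commutator_le_of_commute (closure_α_β _) _ ?_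
    have h : (⁅α (r + 1), β (r + 1)⁆ : H (r + 1)) = (⁅a (r + 1), b (r + 1)⁆ : TreeAut (r + 1)) := rfl
    -- This writes [a, b] through ab⁻¹ alone and its conjugate by a, both known as tuples; the
    -- exponent vector is e_0 minus its shift by σ.
    have h2 : ⁅a (r + 1), b (r + 1)⁆ = a (r + 1) * (a (r + 1) * (b (r + 1))⁻¹)⁻¹ * (a (r + 1))⁻¹ *
        (a (r + 1) * (b (r + 1))⁻¹) := by
      rw [commutatorElement_def]; group
    rw [mem_comap, coe_subtype, h, h2, a_mul_b_inv, ← _root_.map_inv,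
      conj_ofSections (a_nil _) a_cons', ← _root_.map_mul]
    refine mem_map_of_mem _ ⟨fun x => -(Pi.single 0 1 : Fin (r + 1) → ℤ) ((finRotate _)⁻¹ x) +
      (Pi.single 0 1 : Fin (r + 1) → ℤ) x, ?_, fun i => ?_⟩
    · rw [Finset.sum_add_distrib, Finset.sum_neg_distrib,
        Equiv.sum_comp (finRotate (r + 1))⁻¹ (Pi.single 0 1 : Fin (r + 1) → ℤ)]
      simp
    · have hs : ∀ x, Abelianization.of ((Pi.mulSingle 0 (α (r + 1) * β (r + 1)) :
          Fin (r + 1) → H (r + 1)) x) = Abelianization.of (α (r + 1) * β (r + 1)) ^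
            (Pi.single 0 1 : Fin (r + 1) → ℤ) x := by
        intro x
        by_cases hx : x = 0
        · subst hx; simp
        · simp [Pi.single_eq_of_ne hx, Pi.mulSingle_eq_of_ne hx]
      rw [Pi.mul_apply, _root_.map_mul, _root_.map_mul, _root_.map_mul, _root_.map_inv,
        mul_inv_cancel_comm, Pi.inv_apply, _root_.map_inv, hs, hs, zpow_add, zpow_neg]

/-! ### Recursion for the indices of the level stabilizers in H' -/

/-- The stabilizer of the level `n` in `H`, as a subgroup of `H`. -/
def levelKer (m n : ℕ) : Subgroup (H m) := (levelStab m n).subgroupOf (H m)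

theorem mem_levelKer {n : ℕ} {g : H m} : g ∈ levelKer m n ↔ (g : TreeAut m) ∈ levelStab m n := Iff.rfl

instance (n : ℕ) : (levelKer m n).Normal where
  conj_mem := by
    intro g hg h v hv
    change (h : TreeAut m) ((g : TreeAut m) ((h : TreeAut m).symm v)) = v
    have h1 : (g : TreeAut m) ((h : TreeAut m).symm v) = (h : TreeAut m).symm v :=
      hg _ ((H_length m (inv_mem h.2) v).trans hv)
    rw [h1, RelIso.apply_symm_apply]

/-- The product of the commutator subgroup of `H` and the stabilizer of the level `n`. -/
def commKer (m n : ℕ) : Subgroup (H m) := commutator (H m) ⊔ levelKer m n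

instance (n : ℕ) : (commKer m n).Normal := by
  unfold commKer
  infer_instance

theorem commutator_le_commKer (m n : ℕ) : commutator (H m) ≤ commKer m n := le_sup_left

theorem levelKer_le_commKer (m n : ℕ) : levelKer m n ≤ commKer m n := le_sup_right

theorem relIndex_levelStab_H' (m n : ℕ) :
    (levelStab m n).relIndex (H' m) = (levelKer m n).relIndex (commutator (H m)) := by
  rw [H'_eq_map, ← relIndex_comap]
  rfl

theorem comap_ofSections_levelStab (m n : ℕ) :
    (levelStab m (n + 1)).comap (ofSections m) = pi Set.univ fun _ => levelKer m n := by
  ext s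
  rw [mem_comap, ofSections_mem_levelStab, mem_pi]
  simp [mem_levelKer]

theorem ker_compLeft_mk' {G : Type*} [Group G] (N : Subgroup G) [N.Normal] (ι : Type*) :
    ((QuotientGroup.mk' N).compLeft ι).ker = pi Set.univ fun _ => N := by
  ext s
  simp [MonoidHom.mem_ker, funext_iff, mem_pi]

theorem relIndex_pi_const {G : Type*} [Group G] (N C : Subgroup G) [N.Normal] (ι : Type*)
    [Fintype ι] : (pi Set.univ fun _ : ι => N).relIndex (pi Set.univ fun _ => C) =
      N.relIndex C ^ Fintype.card ι := by
  have h : (pi Set.univ fun _ => C).map ((QuotientGroup.mk' N).compLeft ι) =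
      pi Set.univ fun _ => C.map (QuotientGroup.mk' N) := by
    ext u
    simp only [mem_map, mem_pi, Set.mem_univ, true_imp_iff]
    constructor
    · rintro ⟨s, hs, rfl⟩ i
      exact ⟨s i, hs i, rfl⟩
    · intro h
      choose s hs hu using h
      exact ⟨s, hs, funext hu⟩
  rw [← ker_compLeft_mk', relIndex_ker, h,
    show N.relIndex C = (QuotientGroup.mk' N).ker.relIndex C by rw [QuotientGroup.ker_mk'],
    relIndex_ker]
  refine (Nat.card_congr (Equiv.Set.univPi fun _ : ι =>
    ((C.map (QuotientGroup.mk' N) : Subgroup (G ⧸ N)) : Set (G ⧸ N)))).trans ?_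
  rw [Nat.card_pi, Finset.prod_const, Finset.card_univ]
  rfl

/-- The last `r` entries are arbitrary powers of `x`, and they determine the entry at `0`. -/
theorem card_zpow_sum_eq_zero {A : Type*} [Group A] (x : A) (r : ℕ) :
    Nat.card {u : Fin (r + 1) → A // ∃ l : Fin (r + 1) → ℤ, ∑ i, l i = 0 ∧ ∀ i, u i = x ^ l i} =
      orderOf x ^ r := by
  have h : Nat.card (Fin r → zpowers x) = orderOf x ^ r := by
    rw [Nat.card_fun, Nat.card_zpowers, Nat.card_fin]
  rw [← h]
  refine Nat.card_eq_of_bijective (fun u i => ⟨u.1 i.succ, ?_⟩) ⟨?_, ?_⟩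
  · obtain ⟨l, -, hu⟩ := u.2
    exact ⟨l i.succ, (hu _).symm⟩
  · rintro ⟨u, l, hl, hu⟩ ⟨v, k, hk, hv⟩ h
    have hs : ∀ i : Fin r, u i.succ = v i.succ := fun i => congrArg Subtype.val (congrFun h i)
    -- The exponents are determined only modulo the order of `x`, so the sums are compared in
    -- `ZMod`.
    have h0 : x ^ l 0 = x ^ k 0 := by
      rw [Fin.sum_univ_succ] at hl hk
      rw [eq_neg_of_add_eq_zero_left hl, eq_neg_of_add_eq_zero_left hk, zpow_eq_zpow_iff_modEq]
      refine Int.ModEq.neg ?_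
      have hi : ∀ i : Fin r, l i.succ ≡ k i.succ [ZMOD orderOf x] := fun i => by
        rw [← zpow_eq_zpow_iff_modEq, ← hu, ← hv, hs]
      simp only [← ZMod.intCast_eq_intCast_iff, Int.cast_sum] at hi ⊢
      exact Finset.sum_congr rfl fun i _ => hi i
    refine Subtype.ext (funext fun i => ?_)
    induction i using Fin.cases with
    | zero => exact (hu 0).trans (h0.trans (hv 0).symm)
    | succ i => exact hs i
  · intro v
    choose k hk using fun i => (v i).2
    refine ⟨⟨fun i => x ^ (Fin.cons (-∑ i, k i) k : Fin (r + 1) → ℤ) i, _, ?_, fun _ => rfl⟩, ?_⟩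
    · rw [Fin.sum_univ_succ]
      simp
    · funext i
      exact Subtype.ext (by simpa using hk i)

/-- The order of `ab` modulo the product of `H'` and the stabilizer of the level `n`. -/
noncomputable def orderMod (m n : ℕ) : ℕ := orderOf ((α m * β m : H m) : H m ⧸ commKer m n)

theorem zpow_mem_commKer_iff {n : ℕ} {z : ℤ} :
    (α m * β m) ^ z ∈ commKer m n ↔ (orderMod m n : ℤ) ∣ z := by
  rw [orderMod, orderOf_dvd_iff_zpow_eq_one, ← QuotientGroup.mk_zpow, QuotientGroup.eq_one_iff]

theorem mk_eq_of_of_eq {n : ℕ} {g h : H m} (hgh : Abelianization.of g = Abelianization.of h) :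
    (g : H m ⧸ commKer m n) = h := by
  rw [QuotientGroup.eq]
  refine commutator_le_commKer m n ?_
  rw [← Abelianization.ker_of, MonoidHom.mem_ker, _root_.map_mul, _root_.map_inv, hgh,
    inv_mul_cancel]

theorem mem_commKer_congr {n : ℕ} {g h : H m} (hgh : Abelianization.of g = Abelianization.of h) :
    g ∈ commKer m n ↔ h ∈ commKer m n := by
  rw [← QuotientGroup.eq_one_iff, ← QuotientGroup.eq_one_iff, mk_eq_of_of_eq hgh]

theorem relIndex_commKer_branchTuples (r n : ℕ) :
    (pi Set.univ fun _ => commKer (r + 1) n).relIndex (branchTuples (r + 1)) =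
      orderMod (r + 1) n ^ r := by
  rw [← ker_compLeft_mk', relIndex_ker, orderMod, ← card_zpow_sum_eq_zero]
  refine Nat.card_congr (Equiv.subtypeEquivRight fun u => ?_)
  constructor
  · rintro ⟨s, ⟨l, hl, hs⟩, rfl⟩
    refine ⟨l, hl, fun i => ?_⟩
    rw [← QuotientGroup.mk_zpow]
    exact mk_eq_of_of_eq ((hs i).trans (map_zpow _ _ _).symm)
  · rintro ⟨l, hl, hu⟩
    refine ⟨fun i => (α (r + 1) * β (r + 1)) ^ l i, ⟨l, hl, fun i => map_zpow _ _ _⟩, ?_⟩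
    funext i
    rw [hu]
    rfl

/-- The modular law, applicable because tuples with entries in H' lie in `branchTuples`. -/
theorem pi_commKer_inf_branchTuples (m n : ℕ) :
    (pi Set.univ fun _ => commKer m n) ⊓ branchTuples m =
      (pi Set.univ fun _ => commutator (H m)) ⊔
        ((pi Set.univ fun _ => levelKer m n) ⊓ branchTuples m) := by
  have hC : (pi Set.univ fun _ => commutator (H m)) ≤ branchTuples m := by
    intro s hs
    refine ⟨0, by simp, fun i => ?_⟩
    rw [Pi.zero_apply, zpow_zero, ← MonoidHom.mem_ker, Abelianization.ker_of]
    exact hs i trivial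
  apply le_antisymm
  · rintro s ⟨hs, hB⟩
    have h : ∀ i, ∃ y ∈ commutator (H m), ∃ z ∈ levelKer m n, y * z = s i := fun i =>
      mem_sup_of_normal_right.1 (hs i trivial)
    choose y hy z hz hyz using h
    obtain rfl : y * z = s := funext hyz
    have hyC : y ∈ pi Set.univ fun _ => commutator (H m) := fun i _ => hy i
    exact mul_mem_sup hyC ⟨fun i _ => hz i, (mul_mem_cancel_left (hC hyC)).1 hB⟩
  · refine sup_le (le_inf (fun s hs i hi => commutator_le_commKer m n (hs i hi)) hC)
      (inf_le_inf_right _ fun s hs i hi => levelKer_le_commKer m n (hs i hi))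

/-- Let B be `branchTuples` and K = St_H(n). The index of B ∩ K^m in B is split at B ∩ C_n^m. The
upper factor is `relIndex_commKer_branchTuples`; by the modular law, the lower one is the index of
K^m ∩ H'^m in H'^m. -/
theorem relIndex_levelKer_succ (r n : ℕ) :
    (levelKer (r + 1) (n + 1)).relIndex (commutator (H (r + 1))) =
      (levelKer (r + 1) n).relIndex (commutator (H (r + 1))) ^ (r + 1) * orderMod (r + 1) n ^ r := by
  have hle : (pi Set.univ fun _ => levelKer (r + 1) n) ≤
      (pi Set.univ fun _ : Fin (r + 1) => commKer (r + 1) n) :=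
    fun s hs i hi => levelKer_le_commKer _ n (hs i hi)
  have hC : (pi Set.univ fun _ => commutator (H (r + 1))) ≤ branchTuples (r + 1) :=
    (le_sup_left.trans (pi_commKer_inf_branchTuples (r + 1) n).ge).trans inf_le_right
  have hnorm : (pi Set.univ fun _ : Fin (r + 1) => levelKer (r + 1) n).Normal := by
    rw [← ker_compLeft_mk']
    infer_instance
  rw [← relIndex_levelStab_H', ← map_branchTuples, ← relIndex_comap, comap_ofSections_levelStab,
    ← inf_eq_left.2 hle, ← relIndex_inf_mul_relIndex, relIndex_commKer_branchTuples]
  congr 1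
  rw [← inf_relIndex_right, ← inf_assoc, inf_eq_left.2 hle, pi_commKer_inf_branchTuples,
    relIndex_sup_right, ← inf_relIndex_right, inf_assoc, inf_eq_right.2 hC, inf_relIndex_right,
    relIndex_pi_const, Fintype.card_fin]

/-! ### Recursion for the relations between a and b modulo H' and a level stabilizer -/

/-- Multiplying by an element of H' changes the sections, modulo H', by powers of ab with exponent
sum zero. -/
theorem mem_commKer_succ_iff {n : ℕ} {g : H (r + 1)} {s : Fin (r + 1) → H (r + 1)}
    (hg : (g : TreeAut (r + 1)) = ofSections _ s) : g ∈ commKer (r + 1) (n + 1) ↔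
      ∃ l : Fin (r + 1) → ℤ, ∑ i, l i = 0 ∧
        ∀ i, s i * (α (r + 1) * β (r + 1)) ^ l i ∈ commKer (r + 1) n := by
  constructor
  · intro h
    obtain ⟨y, hy, z, hz, rfl⟩ := mem_sup_of_normal_right.1 h
    have hy' : (y : TreeAut (r + 1)) ∈ H' (r + 1) := H'_eq_map (r + 1) ▸ mem_map_of_mem _ hy
    rw [← map_branchTuples] at hy'
    obtain ⟨p, ⟨l, hl, hp⟩, hpy⟩ := hy'
    refine ⟨-l, by simp [hl], fun i => ?_⟩
    have hz' : (z : TreeAut (r + 1)) = ofSections _ (p⁻¹ * s) := by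
      rw [_root_.map_mul, _root_.map_inv, hpy, ← hg, coe_mul, inv_mul_cancel_left]
    have hzi := ofSections_mem_levelStab.1 (hz' ▸ mem_levelKer.1 hz) i
    refine (mem_commKer_congr ?_).1 (levelKer_le_commKer _ n (mem_levelKer.2 hzi))
    rw [Pi.mul_apply, Pi.inv_apply, _root_.map_mul, _root_.map_mul, _root_.map_inv, hp,
      Pi.neg_apply, map_zpow, zpow_neg, mul_comm]
  · rintro ⟨l, hl, hs⟩
    have h : ∀ i, ∃ z ∈ levelKer (r + 1) n, ∃ y ∈ commutator (H (r + 1)),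
        z * y = s i * (α (r + 1) * β (r + 1)) ^ l i := fun i =>
      mem_sup_of_normal_right.1 (sup_comm (commutator (H (r + 1))) _ ▸ hs i)
    choose z hz y hy hzy using h
    have hB : z⁻¹ * s ∈ branchTuples (r + 1) := by
      refine ⟨-l, by simp [hl], fun i => ?_⟩
      have : (z⁻¹ * s) i = y i * (α (r + 1) * β (r + 1)) ^ (-l i) := by
        rw [zpow_neg, Pi.mul_apply, Pi.inv_apply, eq_mul_inv_iff_mul_eq, mul_assoc, ← hzy,
          inv_mul_cancel_left]
      have hy1 : Abelianization.of (y i) = 1 := by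
        rw [← MonoidHom.mem_ker, Abelianization.ker_of]
        exact hy i
      rw [this, _root_.map_mul, hy1, one_mul, map_zpow, Pi.neg_apply]
    have hH' : ofSections _ (z⁻¹ * s) ∈ H' (r + 1) := by
      rw [← map_branchTuples]
      exact mem_map_of_mem _ hB
    rw [H'_eq_map] at hH'
    obtain ⟨p, hp, hpz⟩ := hH'
    have hgp : ((g * p⁻¹ : H (r + 1)) : TreeAut (r + 1)) = ofSections _ z := by
      rw [coe_mul, coe_inv, hg, ← coe_subtype, hpz, ← _root_.map_inv, ← _root_.map_mul]
      congr 1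
      group
    have hgk : g * p⁻¹ ∈ levelKer (r + 1) (n + 1) := by
      rw [mem_levelKer, hgp, ofSections_mem_levelStab]
      exact hz
    simpa using mul_mem (levelKer_le_commKer _ _ hgk) (commutator_le_commKer _ (n + 1) hp)

theorem levelStab_succ_inf_H_le (r n : ℕ) :
    levelStab (r + 1) (n + 1) ⊓ H (r + 1) ≤ levelStab (r + 1) n := by
  rintro g ⟨hg, hH⟩ v hv
  have hadj : (adicTree (r + 1)).Adj (g v) (g (v ++ [0])) :=
    g.map_rel_iff.2 (Or.inr ⟨0, rfl⟩)
  rw [hg (v ++ [0]) (by simp [hv])] at hadj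
  rcases hadj with ⟨x, hx⟩ | ⟨x, hx⟩
  · have := congrArg List.length hx
    simp only [H_length _ hH, List.length_append, List.length_singleton] at this
    omega
  · exact (List.append_inj_left' hx rfl).symm

theorem levelKer_antitone (r : ℕ) : Antitone (levelKer (r + 1)) :=
  antitone_nat_of_succ_le fun n g hg => levelStab_succ_inf_H_le r n ⟨hg, g.2⟩

/-- The pairs `(g, j)` with `g ∈ H` acting on the first level as the power `j` of the cycle. -/
def rotationPairs (m : ℕ) : Subgroup (TreeAut m × Multiplicative ℤ) where
  carrier := {p | p.1 ∈ H m ∧ ∀ x y : Fin m, p.1 [x] = [y] → (y : ℤ) ≡ x + p.2.toAdd [ZMOD m]}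
  one_mem' := by
    refine ⟨one_mem _, fun x y h => ?_⟩
    obtain rfl : x = y := by simpa using h
    simp [Int.ModEq.refl]
  mul_mem' := by
    rintro ⟨g, j⟩ ⟨h, k⟩ ⟨hg, hj⟩ ⟨hh, hk⟩
    refine ⟨mul_mem hg hh, fun x z hxz => ?_⟩
    obtain ⟨y, hy⟩ := List.length_eq_one_iff.1 (H_length m hh [x])
    have h1 := hk x y hy
    have h2 := hj y z (by rw [← hxz, ← hy]; rfl)
    refine h2.trans ((h1.add_right _).trans ?_)
    rw [Prod.mk_mul_mk, toAdd_mul, add_assoc, add_comm k.toAdd]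
  inv_mem' := by
    rintro ⟨g, j⟩ ⟨hg, hj⟩
    refine ⟨inv_mem hg, fun x y hxy => ?_⟩
    have h1 := (hj y x (by rw [← hxy]; exact g.apply_symm_apply _)).symm
    have h2 := h1.add_right (-j.toAdd)
    rw [add_neg_cancel_right] at h2
    exact h2

theorem mem_rotationPairs_of_cons {g : TreeAut (r + 1)} (hg : g ∈ H (r + 1))
    (h : ∀ x, g [x] = [finRotate (r + 1) x]) :
    (g, Multiplicative.ofAdd 1) ∈ rotationPairs (r + 1) := by
  refine ⟨hg, fun x y hxy => ?_⟩
  obtain rfl : finRotate (r + 1) x = y := by simpa [h] using hxy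
  rw [coe_finRotate]
  split_ifs with hx
  · subst hx
    simpa using (Int.modEq_iff_dvd.2 (by simp) : (0 : ℤ) ≡ r + 1 [ZMOD (r + 1 : ℕ)])
  · push_cast
    rfl

/-- On the first level a^x b^y is the rotation by x + y, whereas elements of H' St_H(n+1) fix that
level. -/
theorem dvd_of_mem_commKer_succ {n : ℕ} {x y : ℤ}
    (h : α (r + 1) ^ x * β (r + 1) ^ y ∈ commKer (r + 1) (n + 1)) :
    ((r + 1 : ℕ) : ℤ) ∣ x + y := by
  have ha : (a (r + 1), Multiplicative.ofAdd 1) ∈ rotationPairs (r + 1) :=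
    mem_rotationPairs_of_cons (a_mem_H _) fun x => by rw [a_cons]; split_ifs <;> rfl
  have hb : (b (r + 1), Multiplicative.ofAdd 1) ∈ rotationPairs (r + 1) := by
    refine mem_rotationPairs_of_cons (b_mem_H _) fun x => ?_
    rw [b_cons]
    split_ifs
    · rw [H_apply_nil (inv_mem (b_mem_H _))]
    · rfl
  obtain ⟨-, hab⟩ := mul_mem (zpow_mem ha x) (zpow_mem hb y)
  obtain ⟨p, hp, q, hq, hpq⟩ := mem_sup_of_normal_right.1 h
  have hp' : (p : TreeAut (r + 1)) ∈ H' (r + 1) := H'_eq_map (r + 1) ▸ mem_map_of_mem _ hp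
  rw [← map_branchTuples] at hp'
  obtain ⟨s, -, hs⟩ := hp'
  have hfix : (a (r + 1) ^ x * b (r + 1) ^ y) [0] = [0] := by
    have h1 : a (r + 1) ^ x * b (r + 1) ^ y = (p : TreeAut (r + 1)) * q :=
      (congrArg (Subtype.val) hpq).symm
    have h2 : (q : TreeAut (r + 1)) [0] = [0] :=
      levelKer_antitone r (Nat.le_add_left 1 n) hq [0] rfl
    rw [h1, RelIso.mul_apply, h2, ← hs, ofSections_cons, H_apply_nil (s 0).2]
  have h3 := (hab 0 0 hfix).dvd
  simpa using h3

theorem zpow_mul_zpow_mem_commKer_succ {n : ℕ} {x y : ℤ} :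
    α (r + 1) ^ x * β (r + 1) ^ y ∈ commKer (r + 1) (n + 1) ↔
      ∃ (k : ℤ) (l : Fin (r + 1) → ℤ), x + y = (r + 1 : ℕ) * k ∧ ∑ i, l i = -y ∧
        ∀ i, α (r + 1) ^ (k + l i) * β (r + 1) ^ l i ∈ commKer (r + 1) n := by
  have key : ∀ k : ℤ, x + y = (r + 1 : ℕ) * k →
      (α (r + 1) ^ x * β (r + 1) ^ y ∈ commKer (r + 1) (n + 1) ↔
        ∃ l : Fin (r + 1) → ℤ, ∑ i, l i = -y ∧
          ∀ i, α (r + 1) ^ (k + l i) * β (r + 1) ^ l i ∈ commKer (r + 1) n) := by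
    intro k hk
    -- The power (ab)^{-y} sits at `0`; shifting the exponents by `δ` turns sum zero into sum -y.
    let δ : Fin (r + 1) → ℤ := Pi.single 0 y
    have hδ : ∑ i, δ i = y := by simp [δ]
    have h1 : Abelianization.of (α (r + 1) ^ x * β (r + 1) ^ y) = Abelianization.of
        ((α (r + 1) ^ (r + 1)) ^ k * (α (r + 1) * (β (r + 1))⁻¹) ^ (-y)) := by
      obtain rfl : x = (r + 1 : ℕ) * k - y := by linarith
      simp only [_root_.map_mul, map_zpow, _root_.map_inv, mul_zpow, ← zpow_natCast,
        ← zpow_mul, zpow_sub, zpow_neg, inv_zpow, mul_inv, inv_inv, mul_assoc]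
    have h2 : (((α (r + 1) ^ (r + 1)) ^ k * (α (r + 1) * (β (r + 1))⁻¹) ^ (-y) : H (r + 1)) :
        TreeAut (r + 1)) =
          ofSections _ (fun i => α (r + 1) ^ k * (α (r + 1) * β (r + 1)) ^ (-δ i)) := by
      change (a (r + 1) ^ (r + 1)) ^ k * (a (r + 1) * (b (r + 1))⁻¹) ^ (-y) = _
      rw [a_pow_card, a_mul_b_inv, ← map_zpow, ← map_zpow, ← _root_.map_mul]
      congr 1
      funext i
      rw [Pi.mul_apply, Pi.pow_apply, Pi.pow_apply]
      by_cases hi : i = 0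
      · subst hi; simp [δ]
      · simp [δ, Pi.single_eq_of_ne hi, Pi.mulSingle_eq_of_ne hi]
    have h3 : ∀ (l : Fin (r + 1) → ℤ) i, (α (r + 1) ^ k * (α (r + 1) * β (r + 1)) ^ (-δ i) *
        (α (r + 1) * β (r + 1)) ^ (l i + δ i) ∈ commKer (r + 1) n ↔
          α (r + 1) ^ (k + l i) * β (r + 1) ^ l i ∈ commKer (r + 1) n) := by
      intro l i
      refine mem_commKer_congr ?_
      rw [mul_assoc, ← zpow_add, neg_add_cancel_comm_assoc]
      simp only [_root_.map_mul, map_zpow, mul_zpow, zpow_add, mul_assoc]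
    rw [mem_commKer_congr h1, mem_commKer_succ_iff h2]
    constructor
    · rintro ⟨l, hl, h⟩
      refine ⟨fun i => l i - δ i, by simp [hl, hδ], fun i => (h3 (fun i => l i - δ i) i).1 ?_⟩
      rw [sub_add_cancel]
      exact h i
    · rintro ⟨l, hl, h⟩
      exact ⟨fun i => l i + δ i, by simp [Finset.sum_add_distrib, hl, hδ],
        fun i => (h3 l i).2 (h i)⟩
  constructor
  · intro h
    obtain ⟨k, hk⟩ := dvd_of_mem_commKer_succ h
    obtain ⟨l, hl⟩ := (key k hk).1 h
    exact ⟨k, l, hk, hl⟩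
  · rintro ⟨k, l, hk, hl⟩
    exact (key k hk).2 ⟨l, hl⟩

theorem commKer_zero (m : ℕ) : commKer m 0 = ⊤ := by
  rw [eq_top_iff]
  intro g _
  refine levelKer_le_commKer m 0 fun v hv => ?_
  rw [List.length_eq_zero_iff.1 hv]
  exact H_apply_nil g.2

/-! ### Solving the recursion -/

/-- The orders of `ab` modulo `H'` and the level stabilizers; see `orderMod_eq`. -/
def orderSeq (m : ℕ) : ℕ → ℕ
  | 0 => 1
  | 1 => m / 2 ^ τ m
  | n + 2 => m * orderSeq m n

theorem two_pow_τ_dvd (m : ℕ) : 2 ^ τ m ∣ m := by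
  unfold τ
  split_ifs with h
  · simp
  · simpa using (Nat.not_odd_iff_even.1 h).two_dvd

theorem two_pow_τ_mul_orderSeq (m n : ℕ) :
    2 ^ τ m * orderSeq m (n + 1) * orderSeq m n = m ^ (n + 1) := by
  induction n with
  | zero => simp [orderSeq, Nat.mul_div_cancel' (two_pow_τ_dvd m)]
  | succ n ih =>
    rw [pow_succ, ← ih, orderSeq]
    ring

theorem orderSeq_ne_zero (hm : m ≠ 0) (n : ℕ) : orderSeq m n ≠ 0 := by
  intro h
  have := two_pow_τ_mul_orderSeq m n
  rw [h, mul_zero] at this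
  exact pow_ne_zero _ hm this.symm

/-- The pairs `(x, y)` with `a ^ x * b ^ y` in the product of `H'` and the stabilizer of the level
`n + 1`; see `zpow_mul_zpow_mem_commKer_iff`. -/
def IsRelation (m n : ℕ) (x y : ℤ) : Prop :=
  ∃ u v w : ℤ, x = orderSeq m (n + 1) * u + orderSeq m n * v ∧
    y = orderSeq m (n + 1) * u - orderSeq m n * v + m ^ (n + 1) * w

/-- With t = `orderSeq m (n + 1)`, the condition x = y forces 2v = 2^τ t w. For even m this reads v
= tw; for odd m, t divides a power of m, so it is odd and divides v. -/
theorem isRelation_diag_iff (hm : m ≠ 0) {n : ℕ} {z : ℤ} :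
    IsRelation m n z z ↔ (orderSeq m (n + 1) : ℤ) ∣ z := by
  constructor
  · rintro ⟨u, v, w, h1, h2⟩
    have hM : (2 : ℤ) ^ τ m * orderSeq m (n + 1) * orderSeq m n = m ^ (n + 1) := by
      exact_mod_cast two_pow_τ_mul_orderSeq m n
    have ht : (2 : ℤ) ^ τ m * orderSeq m (n + 1) ∣ m ^ (n + 1) := hM ▸ dvd_mul_right _ _
    have hs : (orderSeq m n : ℤ) ≠ 0 := by exact_mod_cast orderSeq_ne_zero hm n
    have hv : 2 * v = 2 ^ τ m * orderSeq m (n + 1) * w := by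
      refine mul_left_cancel₀ hs ?_
      linear_combination h2 - h1 - w * hM
    suffices h : (orderSeq m (n + 1) : ℤ) ∣ v by
      rw [h1]
      exact dvd_add (dvd_mul_right _ _) (h.mul_left _)
    by_cases hodd : Odd m
    · have hco : IsCoprime (orderSeq m (n + 1) : ℤ) 2 := by
        refine Int.isCoprime_iff_gcd_eq_one.2 ?_
        have h : orderSeq m (n + 1) ∣ m ^ (n + 1) :=
          ⟨2 ^ τ m * orderSeq m n, by rw [← two_pow_τ_mul_orderSeq]; ring⟩
        exact (hodd.pow.of_dvd_nat h).coprime_two_right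
      exact hco.dvd_of_dvd_mul_left ⟨2 ^ τ m * w, by rw [hv]; ring⟩
    · have hτ : τ m = 1 := if_neg hodd
      rw [hτ] at hv
      exact ⟨w, by linarith⟩
  · rintro ⟨u, rfl⟩
    exact ⟨u, 0, 0, by ring, by ring⟩

theorem isRelation_succ_iff {n : ℕ} {x y : ℤ} : IsRelation (r + 1) (n + 1) x y ↔
    ∃ (k : ℤ) (l : Fin (r + 1) → ℤ), x + y = (r + 1 : ℕ) * k ∧ ∑ i, l i = -y ∧
      ∀ i, IsRelation (r + 1) n (k + l i) (l i) := by
  have ht : (orderSeq (r + 1) (n + 2) : ℤ) = (r + 1 : ℕ) * orderSeq (r + 1) n := by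
    rw [orderSeq, Nat.cast_mul]
  constructor
  · rintro ⟨u, v, w, h1, h2⟩
    rw [ht] at h1 h2
    let s : ℤ := orderSeq (r + 1) n
    let t : ℤ := orderSeq (r + 1) (n + 1)
    let δ : Fin (r + 1) → ℤ := Pi.single 0 v
    have hδ : ∑ i, δ i = v := by simp [δ]
    -- The same relation is used at every letter, except that the t-coefficient v is placed wholly
    -- at `0`.
    refine ⟨2 * s * u + (r + 1 : ℕ) ^ (n + 1) * w,
      fun i => -(s * u) - (r + 1 : ℕ) ^ (n + 1) * w + t * δ i, ?_, ?_, fun i =>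
        ⟨δ i, u, -w, ?_, ?_⟩⟩
    · rw [h1, h2]
      simp only [s]
      ring
    · rw [Finset.sum_add_distrib, ← Finset.mul_sum, hδ, h2]
      simp only [s, t, Finset.sum_const, Finset.card_univ, Fintype.card_fin, nsmul_eq_mul]
      ring
    · simp only [s, t]
      ring
    · simp only [s, t]
      ring
  · rintro ⟨k, l, hk, hl, h⟩
    obtain ⟨u, v, w, h1, h2⟩ := h 0
    -- The relations at `i` and at `0` share `k`, so their difference lies on the diagonal.
    have hdvd : ∀ i, (orderSeq (r + 1) (n + 1) : ℤ) ∣ l i - l 0 := by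
      intro i
      obtain ⟨u', v', w', h1', h2'⟩ := h i
      refine (isRelation_diag_iff r.succ_ne_zero).1 ⟨u' - u, v' - v, w' - w, ?_, ?_⟩
      · linear_combination h1' - h1
      · linear_combination h2' - h2
    choose z hz using hdvd
    have hsum : -y = (r + 1 : ℕ) * l 0 + orderSeq (r + 1) (n + 1) * ∑ i, z i := by
      rw [← hl, Finset.mul_sum, ← Finset.sum_congr rfl fun i _ => hz i, Finset.sum_sub_distrib]
      simp
    refine ⟨v, (r + 1 : ℕ) * u + ∑ i, z i, -w, ?_, ?_⟩
    · rw [ht]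
      linear_combination hk + hsum + (r + 1 : ℕ) * h1
    · rw [ht]
      linear_combination -hsum - (r + 1 : ℕ) * h2

/-- As o_0 = 1 and m divides 2o_1, both sides say that m divides x + y. -/
theorem isRelation_zero_iff {x y : ℤ} : IsRelation (r + 1) 0 x y ↔
    ∃ (k : ℤ) (l : Fin (r + 1) → ℤ), x + y = (r + 1 : ℕ) * k ∧ ∑ i, l i = -y := by
  have hm : ((r + 1 : ℕ) : ℤ) ∣ 2 * orderSeq (r + 1) 1 := by
    have h := two_pow_τ_mul_orderSeq (r + 1) 0
    have h1 : 2 ^ τ (r + 1) ∣ 2 := by unfold τ; split_ifs <;> simp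
    obtain ⟨c, hc⟩ := h1
    refine ⟨c, ?_⟩
    have : 2 * orderSeq (r + 1) 1 = (r + 1) * c := by
      calc 2 * orderSeq (r + 1) 1 = (2 ^ τ (r + 1) * c) * orderSeq (r + 1) 1 := by rw [← hc]
        _ = (2 ^ τ (r + 1) * orderSeq (r + 1) (0 + 1) * orderSeq (r + 1) 0) * c := by
          simp only [orderSeq]; ring
        _ = (r + 1) * c := by rw [h]; ring
    exact_mod_cast this
  constructor
  · rintro ⟨u, v, w, h1, h2⟩
    obtain ⟨c, hc⟩ := hm
    refine ⟨c * u + w, Pi.single 0 (-y), ?_, by simp⟩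
    rw [h1, h2, zero_add]
    linear_combination u * hc
  · rintro ⟨k, -, hk, -⟩
    refine ⟨0, x, k, by simp [orderSeq], ?_⟩
    simp only [orderSeq]
    push_cast at hk ⊢
    linear_combination hk

theorem zpow_mul_zpow_mem_commKer_iff {n : ℕ} {x y : ℤ} :
    α (r + 1) ^ x * β (r + 1) ^ y ∈ commKer (r + 1) (n + 1) ↔ IsRelation (r + 1) n x y := by
  induction n generalizing x y with
  | zero => simp only [zpow_mul_zpow_mem_commKer_succ, isRelation_zero_iff, commKer_zero, mem_top,
      implies_true, and_true]
  | succ n ih => simp only [zpow_mul_zpow_mem_commKer_succ (n := n + 1), isRelation_succ_iff, ih]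

theorem orderMod_eq (r n : ℕ) : orderMod (r + 1) n = orderSeq (r + 1) n := by
  have h : ∀ z : ℤ, (orderMod (r + 1) n : ℤ) ∣ z ↔ (orderSeq (r + 1) n : ℤ) ∣ z := by
    intro z
    rw [← zpow_mem_commKer_iff]
    rcases n with _ | n
    · simp [commKer_zero, orderSeq]
    · rw [← isRelation_diag_iff r.succ_ne_zero, ← zpow_mul_zpow_mem_commKer_iff]
      refine mem_commKer_congr ?_
      simp only [_root_.map_mul, map_zpow, mul_zpow]
  exact Nat.dvd_antisymm (Int.natCast_dvd_natCast.1 ((h _).2 dvd_rfl))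
    (Int.natCast_dvd_natCast.1 ((h _).1 dvd_rfl))

/-! ### From indices to the sequence s_n -/

/-- The index of the stabilizer of the level `n` in `H'`. -/
noncomputable def levelIndex (m n : ℕ) : ℕ := (levelKer m n).relIndex (commutator (H m))

theorem levelIndex_succ (r n : ℕ) : levelIndex (r + 1) (n + 1) =
    levelIndex (r + 1) n ^ (r + 1) * orderSeq (r + 1) n ^ r := by
  rw [levelIndex, relIndex_levelKer_succ, orderMod_eq, levelIndex]

theorem relIndex_stab_H' (m n : ℕ) : (stab (H' m) n).relIndex (H' m) = levelIndex m n := by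
  rw [stab, inf_relIndex_right, relIndex_levelStab_H', levelIndex]

theorem levelIndex_ne_zero (m n : ℕ) : levelIndex m n ≠ 0 := by
  have h : stab (H' m) 0 = H' m := by
    refine inf_eq_right.2 fun g hg v hv => ?_
    rw [List.length_eq_zero_iff.1 hv]
    exact H_apply_nil (H'_le_H m hg)
  have h2 := stab_relIndex_ne_zero m 0 n
  rwa [h, relIndex_stab_H'] at h2

theorem relIndex_stab_succ (r n : ℕ) :
    (stab (H' (r + 1)) (n + 1)).relIndex (stab (H' (r + 1)) n) * levelIndex (r + 1) n =
      levelIndex (r + 1) (n + 1) := by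
  rw [← relIndex_stab_H', ← relIndex_stab_H']
  exact relIndex_mul_relIndex _ _ _
    (fun g hg => ⟨levelStab_succ_inf_H_le r n ⟨hg.1, H'_le_H _ hg.2⟩, hg.2⟩) inf_le_right

theorem logb_relIndex_stab (r n : ℕ) :
    Real.logb (r + 1 : ℕ) ((stab (H' (r + 1)) (n + 1)).relIndex (stab (H' (r + 1)) n)) =
      Real.logb (r + 1 : ℕ) (levelIndex (r + 1) (n + 1)) -
        Real.logb (r + 1 : ℕ) (levelIndex (r + 1) n) := by
  rw [← relIndex_stab_succ, Nat.cast_mul, Real.logb_mul, add_sub_cancel_right]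
  · exact_mod_cast stab_relIndex_ne_zero _ _ _
  · exact_mod_cast levelIndex_ne_zero _ _

theorem logb_levelIndex_succ (r n : ℕ) :
    Real.logb (r + 1 : ℕ) (levelIndex (r + 1) (n + 1)) =
      (r + 1 : ℕ) * Real.logb (r + 1 : ℕ) (levelIndex (r + 1) n) +
        r * Real.logb (r + 1 : ℕ) (orderSeq (r + 1) n) := by
  rw [levelIndex_succ, Nat.cast_mul, Nat.cast_pow, Nat.cast_pow, Real.logb_mul, Real.logb_pow,
    Real.logb_pow]
  · exact pow_ne_zero _ (by exact_mod_cast levelIndex_ne_zero _ _)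
  · exact pow_ne_zero _ (by exact_mod_cast orderSeq_ne_zero r.succ_ne_zero _)

/-- The sequence is the difference of two consecutive instances of `logb_levelIndex_succ`, so the
level indices cancel. -/
theorem sSeq_H'_succ (r n : ℕ) : sSeq (H' (r + 1)) (n + 1) =
    r * (Real.logb (r + 1 : ℕ) (orderSeq (r + 1) n) -
      Real.logb (r + 1 : ℕ) (orderSeq (r + 1) (n + 1))) := by
  rw [sSeq, Nat.add_sub_cancel, logb_relIndex_stab, logb_relIndex_stab,
    logb_levelIndex_succ r (n + 1), logb_levelIndex_succ r n]
  push_cast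
  ring

/-- Since o_{n+2} = m o_n, each difference d is followed by -1 - d, while e changes to 1 - e. -/
theorem logb_orderSeq_sub (hm : 2 ≤ m) (n : ℕ) :
    Real.logb m (orderSeq m n) - Real.logb m (orderSeq m (n + 1)) =
      (2 * (e (n + 1) : ℝ) - 1) * (τ m : ℝ) * Real.logb m 2 - e (n + 1) := by
  have hm1 : (1 : ℝ) < m := by exact_mod_cast hm
  have hm0 : (m : ℝ) ≠ 0 := by positivity
  have hself : Real.logb m m = 1 := Real.logb_self_eq_one hm1
  induction n with
  | zero =>
    have h1 : e (0 + 1) = 1 := rfl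
    have h2 : (orderSeq m (0 + 1) : ℝ) = m / 2 ^ τ m := by
      rw [orderSeq, Nat.cast_div (two_pow_τ_dvd m) (by positivity)]
      simp
    rw [h1, h2, Real.logb_div hm0 (by positivity), hself, Real.logb_pow, orderSeq, Nat.cast_one,
      Real.logb_one]
    ring
  | succ n ih =>
    have he : (e (n + 1 + 1) : ℝ) = 1 - e (n + 1) := by
      have : e (n + 1 + 1) + e (n + 1) = 1 := by
        unfold e k
        omega
      rw [eq_sub_iff_add_eq]
      exact_mod_cast this
    have hmul : (orderSeq m (n + 1 + 1) : ℝ) = m * orderSeq m n := by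
      rw [orderSeq, Nat.cast_mul]
    rw [he, hmul, Real.logb_mul hm0 (by exact_mod_cast orderSeq_ne_zero (by omega) n), hself]
    linear_combination -ih

end BSV

theorem mainTheorem5 (m : ℕ) (hm : 2 ≤ m) (n : ℕ) (hn : 1 ≤ n) :
    BSV.sSeq (BSV.H' m) n =
      ((m : ℝ) - 1) *
        ((2 * (BSV.e n : ℝ) - 1) * (BSV.τ m : ℝ) * Real.logb (m : ℝ) 2 - (BSV.e n : ℝ)) := by
  obtain ⟨r, rfl⟩ := Nat.exists_eq_succ_of_ne_zero (show m ≠ 0 by omega)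
  obtain ⟨n, rfl⟩ := Nat.exists_eq_succ_of_ne_zero (show n ≠ 0 by omega)
  rw [Nat.succ_eq_add_one, Nat.succ_eq_add_one, BSV.sSeq_H'_succ, BSV.logb_orderSeq_sub hm,
    Nat.cast_succ, add_sub_cancel_right]
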